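/- Let $M$ be a smooth (Hausdorff) manifold of odd dimension $2m+1$ with an almost contact metric structure $(\xi,\eta,\varphi,g)$: $g$ is a smooth pseudo-Riemannian metric of any signature (in particular it may be Riemannian), $\xi$ a smooth vector field, $\eta$ a smooth 1-form and $\varphi$ a smooth tensor field of type $(1,1)$ such that $\varphi^2=-I+\eta\otimes\xi$, $\eta(\xi)=1$ and $g(\varphi X,\varphi Y)=g(X,Y)-\eta(X)\eta(Y)$. Put $\Omega(X,Y)=g(X,\varphi Y)$, $d\eta(X,Y)=\tfrac12\bigl(X\eta(Y)-Y\eta(X)-\eta([X,Y])\bigr)$, and $N_\varphi(X,Y)=[\varphi X,\varphi Y]+\varphi^2[X,Y]-\varphi[\varphi X,Y]-\varphi[X,\varphi Y]$. Let $\psi$ and $C$ be the endomorphism fields given by $d\eta(X,Y)=g(\psi X,Y)$ and $\tfrac12(L_\xi g)(X,Y)=g(CX,Y)$, let $\widetilde\nabla$ be the Levi-Civita connection of $g$, and let the canonical connection be $$\nabla^N_XY=\widetilde\nabla_XY+(\widetilde\nabla_X\eta)(Y)\,\xi-\eta(Y)\widetilde\nabla_X\xi-\eta(X)(\widetilde\nabla_\xi\eta)(Y)\,\xi-\eta(X)(C+\psi-N)Y,\qquad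 N=2\psi .$$ Suppose that the structure is almost quasi-Sasakian, that is, $$d\Omega=0,\qquad N_\varphi(X,Y)+2\,d\eta(\varphi X,\varphi Y)\,\xi=0,\qquad d\eta(\xi,X)=0$$ for all vector fields $X,Y$. Then it is quasi-Sasakian, that is, $d\Omega=0$ and $N_\varphi(X,Y)+2\,d\eta(X,Y)\,\xi=0$ for all vector fields $X,Y$, if and only if $\nabla^N\varphi=0$, that is, $\nabla^N_X(\varphi Y)=\varphi(\nabla^N_XY)$ for all smooth vector fields $X,Y$. -/

import Mathlib

open Bundle VectorField
open scoped Manifold ContDiff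

set_option linter.unusedSectionVars false

noncomputable section

namespace ContactGeometry

variable {E : Type*} [NormedAddCommGroup E] [NormedSpace ℝ E] [FiniteDimensional ℝ E]
  {H : Type*} [TopologicalSpace H] (I : ModelWithCorners ℝ E H)
  (M : Type*) [TopologicalSpace M] [ChartedSpace H M] [IsManifold I ∞ M]

instance instFiniteDimensionalTangentSpace (p : M) : FiniteDimensional ℝ (TangentSpace I p) :=
  inferInstanceAs (FiniteDimensional ℝ E)

instance instT2SpaceTangentSpace (p : M) : T2Space (TangentSpace I p) :=
  inferInstanceAs (T2Space E)

/-- Vector fields on `M`, without any regularity. -/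
abbrev VField := Π p : M, TangentSpace I p

variable {I M}

/-- `X` is a smooth vector field, i.e. an element of `Γ(TM)`. -/
def IsSmoothField (X : VField I M) : Prop :=
  ContMDiff I (I.prod 𝓘(ℝ, E)) ∞ (fun p ↦ TotalSpace.mk' E p (X p))

/-- `α` is a smooth 1-form on `M`. -/
def IsSmoothOneForm (α : Π p : M, TangentSpace I p →L[ℝ] ℝ) : Prop :=
  ContMDiff I (I.prod 𝓘(ℝ, E →L[ℝ] ℝ)) ∞
    (fun p ↦ TotalSpace.mk' (E →L[ℝ] ℝ)
      (E := fun p : M ↦ TangentSpace I p →L[ℝ] Bundle.Trivial M ℝ p) p (α p))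

/-- `A` is a smooth tensor field of type `(1, 1)` on `M`. -/
def IsSmoothEndo (A : Π p : M, TangentSpace I p →L[ℝ] TangentSpace I p) : Prop :=
  ContMDiff I (I.prod 𝓘(ℝ, E →L[ℝ] E)) ∞
    (fun p ↦ TotalSpace.mk' (E →L[ℝ] E)
      (E := fun p : M ↦ TangentSpace I p →L[ℝ] TangentSpace I p) p (A p))

/-- `b` is a smooth tensor field of type `(0, 2)` on `M`. -/
def IsSmoothBilin (b : Π p : M, TangentSpace I p →L[ℝ] TangentSpace I p →L[ℝ] ℝ) : Prop :=
  ContMDiff I (I.prod 𝓘(ℝ, E →L[ℝ] E →L[ℝ] ℝ)) ∞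
    (fun p ↦ TotalSpace.mk' (E →L[ℝ] E →L[ℝ] ℝ)
      (E := fun p : M ↦ TangentSpace I p →L[ℝ] TangentSpace I p →L[ℝ] Bundle.Trivial M ℝ p)
      p (b p))

theorem IsSmoothOneForm.mdifferentiableAt {α : Π p : M, TangentSpace I p →L[ℝ] ℝ}
    (hα : IsSmoothOneForm α) {X : VField I M} {p : M} (hX : MDiffAt (T% X) p) :
    MDiffAt (fun q ↦ α q (X q)) p := by
  have h : MDifferentiableAt I (I.prod 𝓘(ℝ))
      (fun q ↦ TotalSpace.mk' ℝ (E := Bundle.Trivial M ℝ) q (α q (X q))) p :=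
    MDifferentiableAt.clm_bundle_apply (F₁ := E)
      ((hα p).mdifferentiableAt (by simp)) hX
  simp only [mdifferentiableAt_totalSpace] at h
  exact h.2

theorem IsSmoothBilin.mdifferentiableAt
    {b : Π p : M, TangentSpace I p →L[ℝ] TangentSpace I p →L[ℝ] ℝ}
    (hb : IsSmoothBilin b) {X Y : VField I M} {p : M} (hX : MDiffAt (T% X) p)
    (hY : MDiffAt (T% Y) p) :
    MDiffAt (fun q ↦ b q (X q) (Y q)) p := by
  have h : MDifferentiableAt I (I.prod 𝓘(ℝ))
      (fun q ↦ TotalSpace.mk' ℝ (E := Bundle.Trivial M ℝ) q (b q (X q) (Y q))) p :=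
    MDifferentiableAt.clm_bundle_apply₂ (F₁ := E) (F₂ := E)
      ((hb p).mdifferentiableAt (by simp)) hX hY
  simp only [mdifferentiableAt_totalSpace] at h
  exact h.2

/-- The derivative `X f` of a function along a vector field, at the point `p`. -/
def lieFun (X : VField I M) (f : M → ℝ) (p : M) : ℝ := mvfderiv I f p (X p)

/-- The pairing `q ↦ b(X, Y)(q)` of a `(0, 2)`-tensor field with two vector fields. -/
def pair (b : Π p : M, TangentSpace I p →L[ℝ] TangentSpace I p →L[ℝ] ℝ) (X Y : VField I M) :
    M → ℝ :=
  fun q ↦ b q (X q) (Y q)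

section Calculus

variable {b : Π p : M, TangentSpace I p →L[ℝ] TangentSpace I p →L[ℝ] ℝ}
  {α : Π p : M, TangentSpace I p →L[ℝ] ℝ} {X X' Y Y' Z : VField I M} {f : M → ℝ} {p : M}

theorem IsSmoothBilin.mdiff_pair (hb : IsSmoothBilin b) (hX : MDiffAt (T% X) p)
    (hY : MDiffAt (T% Y) p) : MDiffAt (pair b X Y) p :=
  hb.mdifferentiableAt hX hY

theorem lieFun_smul_left {h : M → ℝ} : lieFun (f • X) h p = f p * lieFun X h p := by
  simp [lieFun]

theorem lieFun_add_left {h : M → ℝ} : lieFun (X + X') h p = lieFun X h p + lieFun X' h p := by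
  simp [lieFun]

theorem lieFun_pair_smul_left (hb : IsSmoothBilin b) (hf : MDiffAt f p) (hX : MDiffAt (T% X) p)
    (hY : MDiffAt (T% Y) p) :
    lieFun Z (pair b (f • X) Y) p = f p * lieFun Z (pair b X Y) p
      + lieFun Z f p * b p (X p) (Y p) := by
  have : pair b (f • X) Y = f * pair b X Y := by ext q; simp [pair]
  rw [this, lieFun, mvfderiv_mul hf (hb.mdiff_pair hX hY)]
  simp [lieFun, pair, mul_comm]

theorem lieFun_pair_smul_right (hb : IsSmoothBilin b) (hf : MDiffAt f p) (hX : MDiffAt (T% X) p)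
    (hY : MDiffAt (T% Y) p) :
    lieFun Z (pair b X (f • Y)) p = f p * lieFun Z (pair b X Y) p
      + lieFun Z f p * b p (X p) (Y p) := by
  have : pair b X (f • Y) = f * pair b X Y := by ext q; simp [pair]
  rw [this, lieFun, mvfderiv_mul hf (hb.mdiff_pair hX hY)]
  simp [lieFun, pair, mul_comm]

theorem lieFun_pair_add_left (hb : IsSmoothBilin b) (hX : MDiffAt (T% X) p)
    (hX' : MDiffAt (T% X') p) (hY : MDiffAt (T% Y) p) :
    lieFun Z (pair b (X + X') Y) p = lieFun Z (pair b X Y) p + lieFun Z (pair b X' Y) p := by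
  have : pair b (X + X') Y = pair b X Y + pair b X' Y := by ext q; simp [pair]
  rw [this, lieFun, mvfderiv_add (hb.mdiff_pair hX hY) (hb.mdiff_pair hX' hY)]
  simp [lieFun]

theorem lieFun_pair_add_right (hb : IsSmoothBilin b) (hX : MDiffAt (T% X) p)
    (hY : MDiffAt (T% Y) p) (hY' : MDiffAt (T% Y') p) :
    lieFun Z (pair b X (Y + Y')) p = lieFun Z (pair b X Y) p + lieFun Z (pair b X Y') p := by
  have : pair b X (Y + Y') = pair b X Y + pair b X Y' := by ext q; simp [pair]
  rw [this, lieFun, mvfderiv_add (hb.mdiff_pair hX hY) (hb.mdiff_pair hX hY')]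
  simp [lieFun]

theorem lieFun_form_smul (hα : IsSmoothOneForm α) (hf : MDiffAt f p) (hX : MDiffAt (T% X) p) :
    lieFun Z (fun q ↦ α q ((f • X) q)) p
      = f p * lieFun Z (fun q ↦ α q (X q)) p + lieFun Z f p * α p (X p) := by
  have : (fun q ↦ α q ((f • X) q)) = f * fun q ↦ α q (X q) := by ext q; simp
  rw [this, lieFun, mvfderiv_mul hf (hα.mdifferentiableAt hX)]
  simp [lieFun, mul_comm]

theorem lieFun_form_add (hα : IsSmoothOneForm α) (hX : MDiffAt (T% X) p)
    (hX' : MDiffAt (T% X') p) :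
    lieFun Z (fun q ↦ α q ((X + X') q)) p
      = lieFun Z (fun q ↦ α q (X q)) p + lieFun Z (fun q ↦ α q (X' q)) p := by
  have : (fun q ↦ α q ((X + X') q)) = (fun q ↦ α q (X q)) + fun q ↦ α q (X' q) := by ext q; simp
  rw [this, lieFun, mvfderiv_add (hα.mdifferentiableAt hX) (hα.mdifferentiableAt hX')]
  simp [lieFun]

theorem bracket_smul_left (hf : MDiffAt f p) (hX : MDiffAt (T% X) p) :
    mlieBracket I (f • X) Y p = -lieFun Y f p • X p + f p • mlieBracket I X Y p := by
  have := FiniteDimensional.complete ℝ E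
  exact mlieBracket_smul_left hf hX

theorem bracket_smul_right (hf : MDiffAt f p) (hY : MDiffAt (T% Y) p) :
    mlieBracket I X (f • Y) p = lieFun X f p • Y p + f p • mlieBracket I X Y p := by
  have := FiniteDimensional.complete ℝ E
  exact mlieBracket_smul_right hf hY

theorem bracket_add_left (hX : MDiffAt (T% X) p) (hX' : MDiffAt (T% X') p) :
    mlieBracket I (X + X') Y p = mlieBracket I X Y p + mlieBracket I X' Y p := by
  have := FiniteDimensional.complete ℝ E
  exact mlieBracket_add_left hX hX'

theorem bracket_add_right (hY : MDiffAt (T% Y) p) (hY' : MDiffAt (T% Y') p) :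
    mlieBracket I X (Y + Y') p = mlieBracket I X Y p + mlieBracket I X Y' p := by
  have := FiniteDimensional.complete ℝ E
  exact mlieBracket_add_right hY hY'

end Calculus

/-! ### Exterior derivatives -/

/-- `dα(X, Y) = (1/2) (X α(Y) - Y α(X) - α([X, Y]))`, on vector fields. -/
def extDerivOneAux (α : Π p : M, TangentSpace I p →L[ℝ] ℝ) (X Y : VField I M) (p : M) : ℝ :=
  (1 / 2) * (lieFun X (fun q ↦ α q (Y q)) p - lieFun Y (fun q ↦ α q (X q)) p
    - α p (mlieBracket I X Y p))

/-- The exterior derivative `dα` of a smooth 1-form, as a `(0, 2)`-tensor field, normalised by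
`dα(X, Y) = (1/2) (X α(Y) - Y α(X) - α([X, Y]))`. -/
def extDerivOne (α : Π p : M, TangentSpace I p →L[ℝ] ℝ) (hα : IsSmoothOneForm α) (p : M) :
    TangentSpace I p →L[ℝ] TangentSpace I p →L[ℝ] ℝ :=
  TensorialAt.mkHom₂ (I := I) (F := E) (F' := E) (fun X Y ↦ extDerivOneAux α X Y p) p
    (fun Y hY ↦
      { smul := fun hf hX ↦ by
          simp only [extDerivOneAux, lieFun_smul_left, lieFun_form_smul hα hf hX,
            bracket_smul_left hf hX, map_add, map_smul, smul_eq_mul]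
          ring
        add := fun hX hX' ↦ by
          simp only [extDerivOneAux, lieFun_add_left, lieFun_form_add hα hX hX',
            bracket_add_left hX hX', map_add]
          ring })
    (fun X hX ↦
      { smul := fun hf hY ↦ by
          simp only [extDerivOneAux, lieFun_smul_left, lieFun_form_smul hα hf hY,
            bracket_smul_right hf hY, map_add, map_smul, smul_eq_mul]
          ring
        add := fun hY hY' ↦ by
          simp only [extDerivOneAux, lieFun_add_left, lieFun_form_add hα hY hY',
            bracket_add_right hY hY', map_add]
          ring })

theorem extDerivOne_apply {α : Π p : M, TangentSpace I p →L[ℝ] ℝ} (hα : IsSmoothOneForm α)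
    {X Y : VField I M} {p : M} (hX : MDiffAt (T% X) p) (hY : MDiffAt (T% Y) p) :
    extDerivOne α hα p (X p) (Y p) = (1 / 2) * (lieFun X (fun q ↦ α q (Y q)) p
      - lieFun Y (fun q ↦ α q (X q)) p - α p (mlieBracket I X Y p)) :=
  TensorialAt.mkHom₂_apply _ _ hX hY

/-- The exterior derivative of a 2-form `β`, evaluated on vector fields:
`3 dβ(X, Y, Z)` is the cyclic sum of `X β(Y, Z) - β([X, Y], Z)`. -/
def extDerivTwo (β : Π p : M, TangentSpace I p →L[ℝ] TangentSpace I p →L[ℝ] ℝ)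
    (X Y Z : VField I M) (p : M) : ℝ :=
  (1 / 3) * (lieFun X (pair β Y Z) p + lieFun Y (pair β Z X) p + lieFun Z (pair β X Y) p
    - β p (mlieBracket I X Y p) (Z p) - β p (mlieBracket I Y Z p) (X p)
    - β p (mlieBracket I Z X p) (Y p))

/-! ### Pseudo-Riemannian metrics and the Levi-Civita connection -/

variable (I M) in
/-- A smooth pseudo-Riemannian metric, of arbitrary signature. -/
structure PseudoMetric where
  /-- The scalar product on each tangent space. -/
  val (p : M) : TangentSpace I p →L[ℝ] TangentSpace I p →L[ℝ] ℝ
  symm (p : M) (v w : TangentSpace I p) : val p v w = val p w v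
  nondegenerate (p : M) (v : TangentSpace I p) : (∀ w, val p v w = 0) → v = 0
  smooth : IsSmoothBilin val

namespace PseudoMetric

variable (g : PseudoMetric I M)

/-- The scalar product on `T_p M` as a bilinear form. -/
def bilin (p : M) : LinearMap.BilinForm ℝ (TangentSpace I p) :=
  (ContinuousLinearMap.coeLM ℝ).comp (g.val p).toLinearMap

theorem bilin_apply (p : M) (v w : TangentSpace I p) : g.bilin p v w = g.val p v w := rfl

theorem bilin_nondegenerate (p : M) : (g.bilin p).Nondegenerate := by
  refine ⟨fun v hv ↦ g.nondegenerate p v hv, fun v hv ↦ g.nondegenerate p v fun w ↦ ?_⟩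
  rw [g.symm]
  exact hv w

/-- The endomorphism `A` of `T_p M` with `g(A u, v) = b(u, v)`, for a bilinear form `b`. -/
def raise (p : M) (b : TangentSpace I p →L[ℝ] TangentSpace I p →L[ℝ] ℝ) :
    TangentSpace I p →L[ℝ] TangentSpace I p :=
  LinearMap.toContinuousLinearMap
    (((g.bilin p).toDual (g.bilin_nondegenerate p)).symm.toLinearMap.comp
      ((ContinuousLinearMap.coeLM ℝ).comp b.toLinearMap))

@[simp]
theorem val_raise (p : M) (b : TangentSpace I p →L[ℝ] TangentSpace I p →L[ℝ] ℝ)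
    (u v : TangentSpace I p) : g.val p (g.raise p b u) v = b u v := by
  rw [← g.bilin_apply]
  exact LinearMap.BilinForm.apply_toDual_symm_apply (hB := g.bilin_nondegenerate p) _ _

theorem ext_val {p : M} {u v : TangentSpace I p} (h : ∀ w, g.val p u w = g.val p v w) : u = v := by
  rw [← sub_eq_zero]
  exact g.nondegenerate p _ fun w ↦ by simp [h w]

/-- The right-hand side of the Koszul formula for `2 g(∇_X Y, Z)`. -/
def koszul (X Y Z : VField I M) (p : M) : ℝ :=
  lieFun X (pair g.val Y Z) p + lieFun Y (pair g.val X Z) p - lieFun Z (pair g.val X Y) p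
    + g.val p (mlieBracket I X Y p) (Z p) - g.val p (mlieBracket I X Z p) (Y p)
    - g.val p (mlieBracket I Y Z p) (X p)

/-- For `Y` differentiable at `p`, the bilinear form `(X, Z) ↦ g(∇_X Y, Z)` on `T_p M`. -/
def koszulForm (Y : VField I M) (p : M) (hY : MDiffAt (T% Y) p) :
    TangentSpace I p →L[ℝ] TangentSpace I p →L[ℝ] ℝ :=
  TensorialAt.mkHom₂ (I := I) (F := E) (F' := E) (fun X Z ↦ (1 / 2) * g.koszul X Y Z p) p
    (fun Z hZ ↦
      { smul := fun {f X} hf hX ↦ by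
          simp only [koszul, lieFun_smul_left, lieFun_pair_smul_left g.smooth hf hX hY,
            lieFun_pair_smul_left g.smooth hf hX hZ,
            bracket_smul_left hf hX, map_add, map_smul, smul_eq_mul,
            add_apply, smul_apply, Pi.smul_apply']
          ring
        add := fun {X X'} hX hX' ↦ by
          simp only [koszul, lieFun_add_left, lieFun_pair_add_left g.smooth hX hX' hY,
            lieFun_pair_add_left g.smooth hX hX' hZ,
            bracket_add_left hX hX', map_add, add_apply, Pi.add_apply]
          ring })
    (fun X hX ↦
      { smul := fun {f Z} hf hZ ↦ by
          simp only [koszul, lieFun_smul_left, lieFun_pair_smul_right g.smooth hf hY hZ,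
            lieFun_pair_smul_right g.smooth hf hX hZ,
            bracket_smul_right hf hZ, map_add, map_smul, smul_eq_mul,
            add_apply, smul_apply, Pi.smul_apply']
          rw [g.symm p (Z p) (Y p), g.symm p (Z p) (X p)]
          ring
        add := fun {Z Z'} hZ hZ' ↦ by
          simp only [koszul, lieFun_add_left, lieFun_pair_add_right g.smooth hY hZ hZ',
            lieFun_pair_add_right g.smooth hX hZ hZ',
            bracket_add_right hZ hZ', map_add, add_apply, Pi.add_apply]
          ring })

theorem koszulForm_apply {X Y Z : VField I M} {p : M} (hX : MDiffAt (T% X) p)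
    (hY : MDiffAt (T% Y) p) (hZ : MDiffAt (T% Z) p) :
    g.koszulForm Y p hY (X p) (Z p) = (1 / 2) * g.koszul X Y Z p :=
  TensorialAt.mkHom₂_apply _ _ hX hZ

open Classical in
/-- The Levi-Civita derivative: `leviCivitaFun g Y p (X p)` is the vector `(∇_X Y)(p)` determined by
the Koszul formula (and the junk value `0` if `Y` is not differentiable at `p`). -/
def leviCivitaFun (Y : VField I M) (p : M) : TangentSpace I p →L[ℝ] TangentSpace I p :=
  if hY : MDiffAt (T% Y) p then g.raise p (g.koszulForm Y p hY) else 0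

theorem val_leviCivitaFun {X Y Z : VField I M} {p : M} (hX : MDiffAt (T% X) p)
    (hY : MDiffAt (T% Y) p) (hZ : MDiffAt (T% Z) p) :
    g.val p (g.leviCivitaFun Y p (X p)) (Z p) = (1 / 2) * g.koszul X Y Z p := by
  rw [leviCivitaFun, dif_pos hY, val_raise, g.koszulForm_apply hX hY hZ]

theorem eq_of_fields {p : M} {A B : TangentSpace I p →L[ℝ] TangentSpace I p}
    (h : ∀ X Z : VField I M, MDiffAt (T% X) p → MDiffAt (T% Z) p →
      g.val p (A (X p)) (Z p) = g.val p (B (X p)) (Z p)) : A = B := by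
  ext u
  refine g.ext_val fun w ↦ ?_
  simpa using h (FiberBundle.extend E u) (FiberBundle.extend E w)
    (FiberBundle.mdifferentiableAt_extend ..) (FiberBundle.mdifferentiableAt_extend ..)

/-- The Levi-Civita connection of a pseudo-Riemannian metric. -/
def leviCivita : CovariantDerivative I E (TangentSpace I : M → Type _) where
  toFun := g.leviCivitaFun
  isCovariantDerivativeOnUniv :=
    { add := fun {Y Y' p} hY hY' _ ↦ by
        refine g.eq_of_fields fun X Z hX hZ ↦ ?_
        simp only [add_apply, map_add]
        rw [g.val_leviCivitaFun hX hY hZ, g.val_leviCivitaFun hX hY' hZ,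
          g.val_leviCivitaFun hX (mdifferentiableAt_add_section hY hY') hZ]
        simp only [koszul, lieFun_add_left, lieFun_pair_add_left g.smooth hY hY' hZ,
          lieFun_pair_add_right g.smooth hX hY hY', bracket_add_left hY hY',
          bracket_add_right hY hY', map_add, add_apply, Pi.add_apply]
        ring
      leibniz := fun {Y f p} hY hf _ ↦ by
        refine g.eq_of_fields fun X Z hX hZ ↦ ?_
        simp only [add_apply, map_add, smul_apply, map_smul, smul_eq_mul,
          ContinuousLinearMap.smulRight_apply]
        rw [g.val_leviCivitaFun hX hY hZ, g.val_leviCivitaFun hX (hf.smul_section hY) hZ]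
        change _ = _ + lieFun X f p * _
        simp only [koszul, lieFun_smul_left, lieFun_pair_smul_left g.smooth hf hY hZ,
          lieFun_pair_smul_right g.smooth hf hX hY, bracket_smul_left hf hY,
          bracket_smul_right hf hY, map_add, map_smul, add_apply, smul_apply, smul_eq_mul,
          Pi.smul_apply']
        rw [g.symm p (Y p) (X p)]
        ring }

/-- The Levi-Civita connection is torsion-free. -/
theorem leviCivita_torsion {X Y : VField I M} {p : M} (hX : MDiffAt (T% X) p)
    (hY : MDiffAt (T% Y) p) :
    g.leviCivita Y p (X p) - g.leviCivita X p (Y p) = mlieBracket I X Y p := by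
  refine g.ext_val fun w ↦ ?_
  have hZ : MDiffAt (T% (FiberBundle.extend E w : VField I M)) p :=
    FiberBundle.mdifferentiableAt_extend ..
  have h1 := g.val_leviCivitaFun hX hY hZ
  have h2 := g.val_leviCivitaFun hY hX hZ
  have hs : pair g.val Y X = pair g.val X Y := by ext q; exact g.symm ..
  simp only [koszul, hs, mlieBracket_swap_apply (V := Y) (W := X), FiberBundle.extend_apply_self,
    map_neg, neg_apply] at h1 h2
  simp only [map_sub, sub_apply]
  change g.val p (g.leviCivitaFun Y p (X p)) w - g.val p (g.leviCivitaFun X p (Y p)) w = _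
  rw [h1, h2]
  ring

/-- The Levi-Civita connection is metric. -/
theorem leviCivita_metric {X Y Z : VField I M} {p : M} (hX : MDiffAt (T% X) p)
    (hY : MDiffAt (T% Y) p) (hZ : MDiffAt (T% Z) p) :
    lieFun X (pair g.val Y Z) p
      = g.val p (g.leviCivita Y p (X p)) (Z p) + g.val p (Y p) (g.leviCivita Z p (X p)) := by
  have h1 := g.val_leviCivitaFun hX hY hZ
  have h2 := g.val_leviCivitaFun hX hZ hY
  have hs : ∀ U V, pair g.val U V = pair g.val V U := fun U V ↦ by ext q; exact g.symm ..
  rw [g.symm p (Y p)]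
  change _ = g.val p (g.leviCivitaFun Y p (X p)) (Z p) + g.val p (g.leviCivitaFun Z p (X p)) (Y p)
  rw [h1, h2]
  simp only [koszul, hs Z Y, mlieBracket_swap_apply (V := Z) (W := Y), map_neg, neg_apply]
  ring

/-- The tensor `C = (1/2) L_ξ g`, where
`(L_ξ g)(X, Y) = ξ g(X, Y) - g([ξ, X], Y) - g(X, [ξ, Y])`. -/
def halfLie (ξ : VField I M) (p : M) : TangentSpace I p →L[ℝ] TangentSpace I p →L[ℝ] ℝ :=
  TensorialAt.mkHom₂ (I := I) (F := E) (F' := E)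
    (fun X Y ↦ (1 / 2) * (lieFun ξ (pair g.val X Y) p - g.val p (mlieBracket I ξ X p) (Y p)
      - g.val p (X p) (mlieBracket I ξ Y p))) p
    (fun Y hY ↦
      { smul := fun {f X} hf hX ↦ by
          simp only [lieFun_pair_smul_left g.smooth hf hX hY, bracket_smul_right hf hX, map_add,
            map_smul, smul_eq_mul, add_apply, smul_apply, Pi.smul_apply']
          ring
        add := fun {X X'} hX hX' ↦ by
          simp only [lieFun_pair_add_left g.smooth hX hX' hY, bracket_add_right hX hX', map_add,
            add_apply, Pi.add_apply]
          ring })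
    (fun X hX ↦
      { smul := fun {f Y} hf hY ↦ by
          simp only [lieFun_pair_smul_right g.smooth hf hX hY, bracket_smul_right hf hY, map_add,
            map_smul, smul_eq_mul, Pi.smul_apply']
          ring
        add := fun {Y Y'} hY hY' ↦ by
          simp only [lieFun_pair_add_right g.smooth hX hY hY', bracket_add_right hY hY', map_add,
            Pi.add_apply]
          ring })

theorem halfLie_apply {ξ X Y : VField I M} {p : M} (hX : MDiffAt (T% X) p)
    (hY : MDiffAt (T% Y) p) :
    g.halfLie ξ p (X p) (Y p) = (1 / 2) * (lieFun ξ (pair g.val X Y) p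
      - g.val p (mlieBracket I ξ X p) (Y p) - g.val p (X p) (mlieBracket I ξ Y p)) :=
  TensorialAt.mkHom₂_apply _ _ hX hY

end PseudoMetric

/-! ### Covariant derivatives of tensor fields -/

/-- The covariant derivative of a smooth 1-form `α`: `covForm cov α hα p u v` is `(∇_u α)(v)`, where
`(∇_X α)(Y) = X α(Y) - α(∇_X Y)`. -/
def covForm (cov : CovariantDerivative I E (TangentSpace I : M → Type _))
    (α : Π p : M, TangentSpace I p →L[ℝ] ℝ) (hα : IsSmoothOneForm α) (p : M) :
    TangentSpace I p →L[ℝ] TangentSpace I p →L[ℝ] ℝ :=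
  TensorialAt.mkHom₂ (I := I) (F := E) (F' := E)
    (fun X Y ↦ lieFun X (fun q ↦ α q (Y q)) p - α p (cov Y p (X p))) p
    (fun Y hY ↦
      { smul := fun {f X} hf hX ↦ by
          simp only [lieFun_smul_left, map_smul, smul_eq_mul, Pi.smul_apply']
          ring
        add := fun {X X'} hX hX' ↦ by
          simp only [lieFun_add_left, map_add, Pi.add_apply]
          ring })
    (fun X hX ↦
      { smul := fun {f Y} hf hY ↦ by
          rw [lieFun_form_smul hα hf hY, cov.isCovariantDerivativeOn.leibniz hY hf]
          simp only [map_smul, smul_eq_mul, add_apply, smul_apply, map_add,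
            ContinuousLinearMap.smulRight_apply, lieFun]
          ring
        add := fun {Y Y'} hY hY' ↦ by
          rw [lieFun_form_add hα hY hY', cov.isCovariantDerivativeOn.add hY hY']
          simp only [map_add, add_apply]
          ring })

theorem covForm_apply (cov : CovariantDerivative I E (TangentSpace I : M → Type _))
    {α : Π p : M, TangentSpace I p →L[ℝ] ℝ} (hα : IsSmoothOneForm α) {X Y : VField I M} {p : M}
    (hX : MDiffAt (T% X) p) (hY : MDiffAt (T% Y) p) :
    covForm cov α hα p (X p) (Y p) = lieFun X (fun q ↦ α q (Y q)) p - α p (cov Y p (X p)) :=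
  TensorialAt.mkHom₂_apply _ _ hX hY

/-- The linear form `u ↦ b(u, v)`. -/
def evalRight {p : M} (b : TangentSpace I p →L[ℝ] TangentSpace I p →L[ℝ] ℝ)
    (v : TangentSpace I p) : TangentSpace I p →L[ℝ] ℝ :=
  LinearMap.toContinuousLinearMap
    { toFun := fun u ↦ b u v
      map_add' := fun u u' ↦ by simp
      map_smul' := fun c u ↦ by simp }

@[simp]
theorem evalRight_apply {p : M} (b : TangentSpace I p →L[ℝ] TangentSpace I p →L[ℝ] ℝ)
    (u v : TangentSpace I p) : evalRight b v u = b u v := rfl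

/-- The vector field `A X` obtained by applying a field of endomorphisms to a vector field. -/
def app (A : Π p : M, TangentSpace I p →L[ℝ] TangentSpace I p) (X : VField I M) : VField I M :=
  fun p ↦ A p (X p)

/-- The covariant derivative of a field of endomorphisms: `(∇_X A) Y = ∇_X (A Y) - A (∇_X Y)`. -/
def covEndo (cov : CovariantDerivative I E (TangentSpace I : M → Type _))
    (A : Π p : M, TangentSpace I p →L[ℝ] TangentSpace I p) (X Y : VField I M) : VField I M :=
  fun p ↦ cov (app A Y) p (X p) - A p (cov Y p (X p))

/-- `∇ A = 0`. -/
def IsParallelEndo (cov : CovariantDerivative I E (TangentSpace I : M → Type _))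
    (A : Π p : M, TangentSpace I p →L[ℝ] TangentSpace I p) : Prop :=
  ∀ X Y : VField I M, IsSmoothField X → IsSmoothField Y → covEndo cov A X Y = 0

/-- The Nijenhuis tensor
`N_A(X, Y) = [A X, A Y] + A² [X, Y] - A [A X, Y] - A [X, A Y]`. -/
def nijenhuis (A : Π p : M, TangentSpace I p →L[ℝ] TangentSpace I p) (X Y : VField I M) :
    VField I M :=
  fun p ↦ mlieBracket I (app A X) (app A Y) p + A p (A p (mlieBracket I X Y p))
    - A p (mlieBracket I (app A X) Y p) - A p (mlieBracket I X (app A Y) p)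

/-! ### Almost contact metric structures -/

variable (I M) in
/-- An almost contact metric structure `(ξ, η, φ, g)` on `M`, with `g` pseudo-Riemannian. -/
structure AlmostContactMetric where
  /-- The metric. -/
  g : PseudoMetric I M
  /-- The structure vector field. -/
  ξ : VField I M
  /-- The contact form. -/
  η : Π p : M, TangentSpace I p →L[ℝ] ℝ
  /-- The structural endomorphism. -/
  φ : Π p : M, TangentSpace I p →L[ℝ] TangentSpace I p
  smooth_ξ : IsSmoothField ξ
  smooth_η : IsSmoothOneForm η
  smooth_φ : IsSmoothEndo φ
  φ_sq (p : M) (v : TangentSpace I p) : φ p (φ p v) = -v + η p v • ξ p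
  η_ξ (p : M) : η p (ξ p) = 1
  compatible (p : M) (v w : TangentSpace I p) :
    g.val p (φ p v) (φ p w) = g.val p v w - η p v * η p w

namespace AlmostContactMetric

variable (S : AlmostContactMetric I M)

/-- The form `ω = dη`. -/
def dη (p : M) : TangentSpace I p →L[ℝ] TangentSpace I p →L[ℝ] ℝ :=
  extDerivOne S.η S.smooth_η p

/-- The fundamental form `Ω(X, Y) = g(X, φ Y)`. -/
def Ω (p : M) : TangentSpace I p →L[ℝ] TangentSpace I p →L[ℝ] ℝ :=
  LinearMap.toContinuousLinearMap
    { toFun := fun u ↦ (S.g.val p u).comp (S.φ p)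
      map_add' := fun u v ↦ by ext w; simp
      map_smul' := fun c u ↦ by ext w; simp }

theorem Ω_apply (p : M) (u v : TangentSpace I p) : S.Ω p u v = S.g.val p u (S.φ p v) := rfl

/-- `dΩ = 0`. -/
def IsClosedΩ : Prop :=
  ∀ X Y Z : VField I M, IsSmoothField X → IsSmoothField Y → IsSmoothField Z →
    ∀ p, extDerivTwo S.Ω X Y Z p = 0

/-- Normality: `N_φ + 2 dη ⊗ ξ = 0`. -/
def IsNormal : Prop :=
  ∀ X Y : VField I M, IsSmoothField X → IsSmoothField Y →
    ∀ p, nijenhuis S.φ X Y p + (2 * S.dη p (X p) (Y p)) • S.ξ p = 0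

/-- Almost normality: `N_φ + 2 φ^* dη ⊗ ξ = 0`. -/
def IsAlmostNormal : Prop :=
  ∀ X Y : VField I M, IsSmoothField X → IsSmoothField Y →
    ∀ p, nijenhuis S.φ X Y p + (2 * S.dη p (S.φ p (X p)) (S.φ p (Y p))) • S.ξ p = 0

/-- Almost quasi-Sasakian: `dΩ = 0`, almost normal, and `dη(ξ, ·) = 0`. -/
structure IsAlmostQuasiSasakian : Prop where
  closed : S.IsClosedΩ
  almostNormal : S.IsAlmostNormal
  dη_ξ : ∀ (p : M) (v : TangentSpace I p), S.dη p (S.ξ p) v = 0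

/-- Quasi-Sasakian: `dΩ = 0` and normal. -/
structure IsQuasiSasakian : Prop where
  closed : S.IsClosedΩ
  normal : S.IsNormal

/-- The second structural endomorphism `ψ`, given by `dη(X, Y) = g(ψ X, Y)`. -/
def ψ (p : M) : TangentSpace I p →L[ℝ] TangentSpace I p := S.g.raise p (S.dη p)

/-- The endomorphism `C`, given by `(1/2) (L_ξ g)(X, Y) = g(C X, Y)`. -/
def C (p : M) : TangentSpace I p →L[ℝ] TangentSpace I p := S.g.raise p (S.g.halfLie S.ξ p)

/-- The `N`-connection of a field of endomorphisms `N`: with `∇` the Levi-Civita connection,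
`∇^N_X Y = ∇_X Y + (∇_X η)(Y) ξ - η(Y) ∇_X ξ - η(X) (∇_ξ η)(Y) ξ - η(X) (C + ψ - N) Y`. -/
def nConnection (N : Π p : M, TangentSpace I p →L[ℝ] TangentSpace I p) :
    CovariantDerivative I E (TangentSpace I : M → Type _) where
  toFun Y p := S.g.leviCivita Y p
    + (evalRight (covForm S.g.leviCivita S.η S.smooth_η p) (Y p)).smulRight (S.ξ p)
    - S.η p (Y p) • S.g.leviCivita S.ξ p
    - (covForm S.g.leviCivita S.η S.smooth_η p (S.ξ p) (Y p)) • (S.η p).smulRight (S.ξ p)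
    - (S.η p).smulRight (S.C p (Y p) + S.ψ p (Y p) - N p (Y p))
  isCovariantDerivativeOnUniv :=
    { add := fun {Y Y' p} hY hY' _ ↦ by
        ext u
        simp [S.g.leviCivita.isCovariantDerivativeOn.add hY hY']
        module
      leibniz := fun {Y f p} hY hf _ ↦ by
        ext u
        simp [S.g.leviCivita.isCovariantDerivativeOn.leibniz hY hf]
        module }

/-- The displayed formula for the `N`-connection, on vector fields. -/
theorem nConnection_apply (N : Π p : M, TangentSpace I p →L[ℝ] TangentSpace I p)
    (X Y : VField I M) (p : M) :
    S.nConnection N Y p (X p) = S.g.leviCivita Y p (X p)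
      + covForm S.g.leviCivita S.η S.smooth_η p (X p) (Y p) • S.ξ p
      - S.η p (Y p) • S.g.leviCivita S.ξ p (X p)
      - (S.η p (X p) * covForm S.g.leviCivita S.η S.smooth_η p (S.ξ p) (Y p)) • S.ξ p
      - S.η p (X p) • (S.C p + S.ψ p - N p) (Y p) := by
  simp [nConnection]
  module

/-- The canonical connection: the `N`-connection with `N = 2 ψ`. -/
def canonicalConnection : CovariantDerivative I E (TangentSpace I : M → Type _) :=
  S.nConnection fun p ↦ (2 : ℝ) • S.ψ p

end AlmostContactMetric

end ContactGeometry

end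

noncomputable section

namespace ContactGeometry

variable {E : Type*} [NormedAddCommGroup E] [NormedSpace ℝ E] [FiniteDimensional ℝ E]
  {H : Type*} [TopologicalSpace H] {I : ModelWithCorners ℝ E H}
  {M : Type*} [TopologicalSpace M] [ChartedSpace H M] [IsManifold I ∞ M]

/-! ### Smooth vector fields -/

/-- On a Hausdorff manifold every tangent vector is the value of a global smooth vector field. -/
theorem exists_isSmoothField_eq [T2Space M] {p : M} (v : TangentSpace I p) :
    ∃ X : VField I M, IsSmoothField X ∧ X p = v := by
  obtain ⟨s, hs, hsv⟩ := FiberBundle.exists_contMDiffOn_extend (k := ∞) I E v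
  obtain ⟨u, hus, hu, hpu⟩ := mem_nhds_iff.1 hs
  obtain ⟨f, -, hf⟩ := (SmoothBumpFunction.nhds_basis_tsupport (I := I) p).mem_iff.1
    (hu.mem_nhds hpu)
  refine ⟨(f : M → ℝ) • (FiberBundle.extend E v : VField I M),
    ContMDiffOn.smul_section_of_tsupport f.contMDiff.contMDiffOn hu hf (hsv.mono hus), ?_⟩
  simp

theorem IsSmoothField.mdiffAt {X : VField I M} (hX : IsSmoothField X) (p : M) :
    MDiffAt (T% X) p :=
  (hX p).mdifferentiableAt (by simp)

theorem IsSmoothEndo.mdiffAt_app {A : Π p : M, TangentSpace I p →L[ℝ] TangentSpace I p}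
    (hA : IsSmoothEndo A) {X : VField I M} {p : M} (hX : MDiffAt (T% X) p) :
    MDiffAt (T% (app A X)) p :=
  MDifferentiableAt.clm_bundle_apply (F₁ := E) (F₂ := E) ((hA p).mdifferentiableAt (by simp)) hX

/-! ### The covariant derivative of an endomorphism field as a tensor -/

/-- The covariant derivative of a smooth endomorphism field `A` as a tensor:
`covEndoTensor cov A hA p u v` is `(∇_u A) v`. -/
def covEndoTensor (cov : CovariantDerivative I E (TangentSpace I : M → Type _))
    (A : Π p : M, TangentSpace I p →L[ℝ] TangentSpace I p) (hA : IsSmoothEndo A) (p : M) :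
    TangentSpace I p →L[ℝ] TangentSpace I p →L[ℝ] TangentSpace I p :=
  TensorialAt.mkHom₂ (I := I) (F := E) (F' := E) (fun X Y ↦ covEndo cov A X Y p) p
    (fun Y hY ↦
      { smul := fun {f X} hf hX ↦ by
          simp only [covEndo, map_smul, Pi.smul_apply', smul_sub]
        add := fun {X X'} hX hX' ↦ by
          simp only [covEndo, map_add, Pi.add_apply]
          abel })
    (fun X hX ↦
      { smul := fun {f Y} hf hY ↦ by
          have h : app A (f • Y) = f • app A Y := by ext q; simp [app]
          simp only [covEndo, h]
          rw [cov.isCovariantDerivativeOn.leibniz hY hf,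
            cov.isCovariantDerivativeOn.leibniz (hA.mdiffAt_app hY) hf]
          simp only [map_smul, add_apply, smul_apply, map_add,
            ContinuousLinearMap.smulRight_apply, app]
          module
        add := fun {Y Y'} hY hY' ↦ by
          have h : app A (Y + Y') = app A Y + app A Y' := by ext q; simp [app]
          simp only [covEndo, h]
          rw [cov.isCovariantDerivativeOn.add hY hY',
            cov.isCovariantDerivativeOn.add (hA.mdiffAt_app hY) (hA.mdiffAt_app hY')]
          simp only [map_add, add_apply]
          abel })

theorem covEndoTensor_apply (cov : CovariantDerivative I E (TangentSpace I : M → Type _))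
    {A : Π p : M, TangentSpace I p →L[ℝ] TangentSpace I p} (hA : IsSmoothEndo A)
    {X Y : VField I M} {p : M} (hX : MDiffAt (T% X) p) (hY : MDiffAt (T% Y) p) :
    covEndoTensor cov A hA p (X p) (Y p) = cov (app A Y) p (X p) - A p (cov Y p (X p)) :=
  TensorialAt.mkHom₂_apply _ _ hX hY

/-- A smooth endomorphism field is parallel iff its covariant derivative vanishes as a tensor. -/
theorem isParallelEndo_iff [T2Space M]
    (cov : CovariantDerivative I E (TangentSpace I : M → Type _))
    {A : Π p : M, TangentSpace I p →L[ℝ] TangentSpace I p} (hA : IsSmoothEndo A) :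
    IsParallelEndo cov A ↔
      ∀ (p : M) (u v : TangentSpace I p), covEndoTensor cov A hA p u v = 0 := by
  constructor
  · intro h p u v
    obtain ⟨X, hX, rfl⟩ := exists_isSmoothField_eq u
    obtain ⟨Y, hY, rfl⟩ := exists_isSmoothField_eq v
    rw [covEndoTensor_apply cov hA (hX.mdiffAt p) (hY.mdiffAt p)]
    exact congrFun (h X Y hX hY) p
  · intro h X Y hX hY
    ext p
    exact (covEndoTensor_apply cov hA (hX.mdiffAt p) (hY.mdiffAt p)).symm.trans
      (h p (X p) (Y p))

namespace AlmostContactMetric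

variable (S : AlmostContactMetric I M) {p : M}

/-! ### Pointwise identities -/

theorem φ_ξ (p : M) : S.φ p (S.ξ p) = 0 := by
  have h2 : S.φ p (S.φ p (S.ξ p)) = 0 := by simp [S.φ_sq, S.η_ξ]
  have h3 : S.φ p (S.ξ p) = S.η p (S.φ p (S.ξ p)) • S.ξ p := by
    have := S.φ_sq p (S.φ p (S.ξ p))
    rw [h2, map_zero] at this
    exact neg_add_eq_zero.1 this.symm
  have h4 : S.η p (S.φ p (S.ξ p)) * S.η p (S.φ p (S.ξ p)) = 0 := by
    have h5 : S.φ p (S.φ p (S.ξ p)) = S.η p (S.φ p (S.ξ p)) • S.φ p (S.ξ p) := by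
      conv_lhs => rw [h3, map_smul]
    have h6 := congrArg (S.η p) h5
    rw [h2, map_zero, map_smul, smul_eq_mul] at h6
    exact h6.symm
  rw [h3, mul_self_eq_zero.1 h4, zero_smul]

theorem η_φ (v : TangentSpace I p) : S.η p (S.φ p v) = 0 := by
  have h := S.φ_sq p (S.φ p v)
  rw [S.φ_sq p v, map_add, map_neg, map_smul, S.φ_ξ, smul_zero, add_zero] at h
  have := congrArg (S.η p) h
  simpa [S.η_ξ] using this

theorem val_ξ_right (v : TangentSpace I p) : S.g.val p v (S.ξ p) = S.η p v := by
  have h := S.compatible p v (S.ξ p)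
  rw [S.φ_ξ, map_zero, S.η_ξ] at h
  linarith

theorem val_ξ_left (v : TangentSpace I p) : S.g.val p (S.ξ p) v = S.η p v := by
  rw [S.g.symm, val_ξ_right]

/-- `φ` is skew-symmetric with respect to `g`. -/
theorem val_φ_left (v w : TangentSpace I p) :
    S.g.val p (S.φ p v) w = -S.g.val p v (S.φ p w) := by
  have h := S.compatible p v (S.φ p w)
  rw [S.φ_sq, map_add, map_neg, map_smul, S.val_ξ_right, S.η_φ, S.η_φ] at h
  simp only [smul_zero, add_zero, mul_zero, sub_zero] at h
  linarith

/-- The endomorphism field `X ↦ ∇_X ξ` of the Levi-Civita connection. -/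
def gradξ (p : M) : TangentSpace I p →L[ℝ] TangentSpace I p := S.g.leviCivita S.ξ p

/-- The tensor `(X, Y) ↦ (∇_X φ) Y` of the Levi-Civita connection. -/
def gradφ (p : M) : TangentSpace I p →L[ℝ] TangentSpace I p →L[ℝ] TangentSpace I p :=
  covEndoTensor S.g.leviCivita S.φ S.smooth_φ p

theorem gradφ_apply {X Y : VField I M} (hX : MDiffAt (T% X) p) (hY : MDiffAt (T% Y) p) :
    S.gradφ p (X p) (Y p)
      = S.g.leviCivita (app S.φ Y) p (X p) - S.φ p (S.g.leviCivita Y p (X p)) :=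
  covEndoTensor_apply _ S.smooth_φ hX hY

theorem mdiffAt_ξ (p : M) : MDiffAt (T% S.ξ) p := S.smooth_ξ.mdiffAt p

theorem lieFun_η {X Y : VField I M} (hX : MDiffAt (T% X) p) (hY : MDiffAt (T% Y) p) :
    lieFun X (fun q ↦ S.η q (Y q)) p
      = S.g.val p (S.gradξ p (X p)) (Y p) + S.η p (S.g.leviCivita Y p (X p)) := by
  have h : (fun q ↦ S.η q (Y q)) = pair S.g.val S.ξ Y := by
    ext q
    exact (S.val_ξ_left _).symm
  rw [h, S.g.leviCivita_metric hX (S.mdiffAt_ξ p) hY, S.val_ξ_left]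
  rfl

theorem exists_mdiffAt_eq (v : TangentSpace I p) :
    ∃ X : VField I M, MDiffAt (T% X) p ∧ X p = v :=
  ⟨FiberBundle.extend E v, FiberBundle.mdifferentiableAt_extend .., by simp⟩

/-- `(∇_X η)(Y) = g(∇_X ξ, Y)`. -/
theorem covForm_η (u v : TangentSpace I p) :
    covForm S.g.leviCivita S.η S.smooth_η p u v = S.g.val p (S.gradξ p u) v := by
  obtain ⟨X, hX, rfl⟩ := exists_mdiffAt_eq u
  obtain ⟨Y, hY, rfl⟩ := exists_mdiffAt_eq v
  rw [covForm_apply _ _ hX hY, S.lieFun_η hX hY]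
  ring

/-- `dη` is the skew-symmetric part of `∇ ξ`. -/
theorem dη_eq (u v : TangentSpace I p) :
    S.dη p u v = (1 / 2) * (S.g.val p (S.gradξ p u) v - S.g.val p (S.gradξ p v) u) := by
  obtain ⟨X, hX, rfl⟩ := exists_mdiffAt_eq u
  obtain ⟨Y, hY, rfl⟩ := exists_mdiffAt_eq v
  rw [dη, extDerivOne_apply _ hX hY, S.lieFun_η hX hY, S.lieFun_η hY hX,
    ← S.g.leviCivita_torsion hX hY, map_sub]
  ring

/-- `(1/2) L_ξ g` is the symmetric part of `∇ ξ`. -/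
theorem halfLie_eq (u v : TangentSpace I p) :
    S.g.halfLie S.ξ p u v
      = (1 / 2) * (S.g.val p (S.gradξ p u) v + S.g.val p (S.gradξ p v) u) := by
  obtain ⟨X, hX, rfl⟩ := exists_mdiffAt_eq u
  obtain ⟨Y, hY, rfl⟩ := exists_mdiffAt_eq v
  have hξ := S.mdiffAt_ξ p
  rw [S.g.halfLie_apply hX hY, S.g.leviCivita_metric hξ hX hY,
    ← S.g.leviCivita_torsion hξ hX, ← S.g.leviCivita_torsion hξ hY, map_sub, map_sub, sub_apply,
    S.g.symm p (S.gradξ p (Y p))]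
  simp only [gradξ]
  ring

/-- `C + ψ = ∇ ξ`. -/
theorem C_add_ψ (v : TangentSpace I p) : S.C p v + S.ψ p v = S.gradξ p v := by
  refine S.g.ext_val fun w ↦ ?_
  rw [map_add, add_apply, C, ψ, S.g.val_raise, S.g.val_raise, S.halfLie_eq, S.dη_eq]
  ring

/-- `∇ φ` is skew-symmetric with respect to `g`. -/
theorem val_gradφ (u v w : TangentSpace I p) :
    S.g.val p (S.gradφ p u v) w = -S.g.val p v (S.gradφ p u w) := by
  obtain ⟨X, hX, rfl⟩ := exists_mdiffAt_eq u
  obtain ⟨Y, hY, rfl⟩ := exists_mdiffAt_eq v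
  obtain ⟨Z, hZ, rfl⟩ := exists_mdiffAt_eq w
  have hφY := S.smooth_φ.mdiffAt_app hY
  have hφZ := S.smooth_φ.mdiffAt_app hZ
  have h : pair S.g.val (app S.φ Y) Z = -pair S.g.val Y (app S.φ Z) := by
    ext q
    exact S.val_φ_left _ _
  have h1 := S.g.leviCivita_metric hX hφY hZ
  have h2 := S.g.leviCivita_metric hX hY hφZ
  have h3 : lieFun X (-pair S.g.val Y (app S.φ Z)) p = -lieFun X (pair S.g.val Y (app S.φ Z)) p := by
    simp [lieFun, mvfderiv_neg]
  rw [h, h3, h2] at h1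
  rw [S.gradφ_apply hX hY, S.gradφ_apply hX hZ, map_sub, map_sub, sub_apply, S.val_φ_left,
    ← neg_eq_iff_eq_neg.2 (S.val_φ_left (Y p) (S.g.leviCivita Z p (X p)))]
  simp only [app] at h1 ⊢
  linarith

/-- The covariant derivative of the identity `φ² = -1 + η ⊗ ξ`. -/
theorem gradφ_φ (u v : TangentSpace I p) :
    S.gradφ p u (S.φ p v) + S.φ p (S.gradφ p u v)
      = S.g.val p (S.gradξ p u) v • S.ξ p + S.η p v • S.gradξ p u := by
  obtain ⟨X, hX, rfl⟩ := exists_mdiffAt_eq u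
  obtain ⟨Y, hY, rfl⟩ := exists_mdiffAt_eq v
  have hφY := S.smooth_φ.mdiffAt_app hY
  have hη : MDiffAt (fun q ↦ S.η q (Y q)) p := S.smooth_η.mdifferentiableAt hY
  have h1 := S.gradφ_apply hX hφY
  have h : app S.φ (app S.φ Y) = (fun _ : M ↦ (-1 : ℝ)) • Y + (fun q : M ↦ S.η q (Y q)) • S.ξ := by
    ext q
    simp [app, S.φ_sq]
  have hc : MDiffAt (fun _ : M ↦ (-1 : ℝ)) p := mdifferentiableAt_const
  have h2 : S.g.leviCivita (app S.φ (app S.φ Y)) p (X p)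
      = -S.g.leviCivita Y p (X p) + S.η p (Y p) • S.gradξ p (X p)
        + lieFun X (fun q ↦ S.η q (Y q)) p • S.ξ p := by
    rw [h, S.g.leviCivita.isCovariantDerivativeOn.add (hc.smul_section hY)
      (hη.smul_section (S.mdiffAt_ξ p)), S.g.leviCivita.isCovariantDerivativeOn.leibniz hY hc,
      S.g.leviCivita.isCovariantDerivativeOn.leibniz (S.mdiffAt_ξ p) hη]
    have h0 : mvfderiv I (fun _ : M ↦ (-1 : ℝ)) p = 0 := mvfderiv_const ..
    simp [lieFun, gradξ, add_assoc, h0]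
  rw [h2, S.lieFun_η hX hY] at h1
  simp only [app] at h1
  rw [h1, S.gradφ_apply hX hY, map_sub, S.φ_sq]
  module

/-- The Nijenhuis tensor of `φ` in terms of `∇ φ`. -/
theorem nijenhuis_eq {X Y : VField I M} (hX : MDiffAt (T% X) p) (hY : MDiffAt (T% Y) p) :
    nijenhuis S.φ X Y p
      = S.gradφ p (S.φ p (X p)) (Y p) - S.gradφ p (S.φ p (Y p)) (X p)
        + S.φ p (S.gradφ p (Y p) (X p)) - S.φ p (S.gradφ p (X p) (Y p)) := by
  have hφX := S.smooth_φ.mdiffAt_app hX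
  have hφY := S.smooth_φ.mdiffAt_app hY
  have h1 := S.gradφ_apply hφX hY
  have h2 := S.gradφ_apply hφY hX
  rw [S.gradφ_apply hX hY, S.gradφ_apply hY hX, nijenhuis,
    ← S.g.leviCivita_torsion hφX hφY, ← S.g.leviCivita_torsion hX hY,
    ← S.g.leviCivita_torsion hφX hY, ← S.g.leviCivita_torsion hX hφY]
  simp only [app] at h1 h2 ⊢
  rw [h1, h2]
  simp only [map_sub]
  abel

/-- `3 dΩ` is the cyclic sum of `∇ Ω`. -/
theorem extDerivTwo_Ω_eq {X Y Z : VField I M} (hX : MDiffAt (T% X) p) (hY : MDiffAt (T% Y) p)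
    (hZ : MDiffAt (T% Z) p) :
    extDerivTwo S.Ω X Y Z p
      = (1 / 3) * (S.g.val p (Y p) (S.gradφ p (X p) (Z p))
        + S.g.val p (Z p) (S.gradφ p (Y p) (X p)) + S.g.val p (X p) (S.gradφ p (Z p) (Y p))) := by
  have key {U V W : VField I M} (hU : MDiffAt (T% U) p) (hV : MDiffAt (T% V) p)
      (hW : MDiffAt (T% W) p) :
      lieFun U (pair S.Ω V W) p = S.g.val p (V p) (S.gradφ p (U p) (W p))
        + S.Ω p (S.g.leviCivita V p (U p)) (W p) + S.Ω p (V p) (S.g.leviCivita W p (U p)) := by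
    have h : pair S.Ω V W = pair S.g.val V (app S.φ W) := rfl
    rw [h, S.g.leviCivita_metric hU hV (S.smooth_φ.mdiffAt_app hW), S.gradφ_apply hU hW, map_sub,
      S.Ω_apply, S.Ω_apply]
    simp only [app]
    ring
  have skew (u v : TangentSpace I p) : S.Ω p u v = -S.Ω p v u := by
    rw [S.Ω_apply, S.Ω_apply, ← S.val_φ_left, S.g.symm]
  rw [extDerivTwo, key hX hY hZ, key hY hZ hX, key hZ hX hY, ← S.g.leviCivita_torsion hX hY,
    ← S.g.leviCivita_torsion hY hZ, ← S.g.leviCivita_torsion hZ hX]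
  simp only [map_sub, sub_apply]
  rw [skew (Y p) (S.g.leviCivita Z p (X p)), skew (Z p) (S.g.leviCivita X p (Y p)),
    skew (X p) (S.g.leviCivita Y p (Z p))]
  ring

theorem η_gradξ (u : TangentSpace I p) : S.η p (S.gradξ p u) = 0 := by
  have h := congrArg (S.η p) (S.gradφ_φ u (S.ξ p))
  rw [S.φ_ξ, map_zero, zero_add, S.η_φ, S.val_ξ_right, S.η_ξ] at h
  simp only [map_add, map_smul, S.η_ξ, smul_eq_mul] at h
  linarith

/-- `(∇_X φ) ξ = -φ ∇_X ξ`. -/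
theorem gradφ_ξ (u : TangentSpace I p) : S.gradφ p u (S.ξ p) = -S.φ p (S.gradξ p u) := by
  have h := S.gradφ_φ u (S.ξ p)
  rw [S.φ_ξ, map_zero, zero_add, S.val_ξ_right, S.η_gradξ, S.η_ξ, zero_smul, zero_add,
    one_smul] at h
  have h0 : S.η p (S.gradφ p u (S.ξ p)) = 0 := by
    have := S.val_gradφ u (S.ξ p) (S.ξ p)
    rw [S.val_ξ_right, S.val_ξ_left] at this
    linarith
  rw [← h, S.φ_sq, h0, zero_smul, add_zero, neg_neg]

theorem η_gradφ (u v : TangentSpace I p) :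
    S.η p (S.gradφ p u v) = S.g.val p v (S.φ p (S.gradξ p u)) := by
  rw [← S.val_ξ_right, S.val_gradφ, S.gradφ_ξ, map_neg, neg_neg]

variable {S}

/-! ### The structure equations at a point -/

/-- `dΩ = 0` in terms of `∇ φ`. -/
theorem IsClosedΩ.gradφ_cyclic [T2Space M] (h : S.IsClosedΩ) (u v w : TangentSpace I p) :
    S.g.val p v (S.gradφ p u w) + S.g.val p w (S.gradφ p v u)
      + S.g.val p u (S.gradφ p w v) = 0 := by
  obtain ⟨X, hX, rfl⟩ := exists_isSmoothField_eq u
  obtain ⟨Y, hY, rfl⟩ := exists_isSmoothField_eq v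
  obtain ⟨Z, hZ, rfl⟩ := exists_isSmoothField_eq w
  have := h X Y Z hX hY hZ p
  rw [S.extDerivTwo_Ω_eq (hX.mdiffAt p) (hY.mdiffAt p) (hZ.mdiffAt p)] at this
  linarith

/-- Almost normality in terms of `∇ φ`. -/
theorem IsAlmostNormal.gradφ_eq [T2Space M] (h : S.IsAlmostNormal) (u v : TangentSpace I p) :
    S.gradφ p (S.φ p u) v - S.gradφ p (S.φ p v) u + S.φ p (S.gradφ p v u)
      - S.φ p (S.gradφ p u v) + (2 * S.dη p (S.φ p u) (S.φ p v)) • S.ξ p = 0 := by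
  obtain ⟨X, hX, rfl⟩ := exists_isSmoothField_eq u
  obtain ⟨Y, hY, rfl⟩ := exists_isSmoothField_eq v
  have := h X Y hX hY p
  rwa [S.nijenhuis_eq (hX.mdiffAt p) (hY.mdiffAt p)] at this

/-- An almost normal structure is normal iff `dη` is `φ`-invariant. -/
theorem IsAlmostNormal.isNormal_iff [T2Space M] (h : S.IsAlmostNormal) :
    S.IsNormal ↔ ∀ (p : M) (u v : TangentSpace I p),
      S.dη p (S.φ p u) (S.φ p v) = S.dη p u v := by
  constructor
  · intro hn p u v
    obtain ⟨X, hX, rfl⟩ := exists_isSmoothField_eq u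
    obtain ⟨Y, hY, rfl⟩ := exists_isSmoothField_eq v
    have h1 := congrArg (S.η p) ((h X Y hX hY p).trans (hn X Y hX hY p).symm)
    simp only [map_add, map_smul, S.η_ξ, smul_eq_mul] at h1
    linarith
  · intro hd X Y hX hY p
    rw [← hd]
    exact h X Y hX hY p

namespace IsAlmostQuasiSasakian

variable [T2Space M]

theorem gradξ_ξ (hS : S.IsAlmostQuasiSasakian) (p : M) : S.gradξ p (S.ξ p) = 0 := by
  refine S.g.nondegenerate p _ fun w ↦ ?_
  have h := hS.dη_ξ p w
  rw [S.dη_eq, S.val_ξ_right, S.η_gradξ] at h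
  linarith

/-- `∇_ξ φ = [∇ ξ, φ]`, i.e. `L_ξ φ = 0`. -/
theorem gradφ_ξ_left (hS : S.IsAlmostQuasiSasakian) (u : TangentSpace I p) :
    S.gradφ p (S.ξ p) u = S.gradξ p (S.φ p u) - S.φ p (S.gradξ p u) := by
  have h := congrArg (S.φ p) (hS.almostNormal.gradφ_eq u (S.ξ p))
  simp only [S.φ_ξ, map_zero, S.gradφ_ξ, map_add, map_sub, map_neg, map_smul, S.φ_sq,
    S.η_gradξ, S.η_gradφ, hS.gradξ_ξ, zero_apply, smul_zero, zero_smul] at h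
  rw [eq_comm, ← sub_eq_zero, ← h]
  abel

/-- `∇ ξ` is skew-symmetric, i.e. `ξ` is a Killing field. -/
theorem val_gradξ (hS : S.IsAlmostQuasiSasakian) (u v : TangentSpace I p) :
    S.g.val p (S.gradξ p u) v = -S.g.val p (S.gradξ p v) u := by
  have key (w : TangentSpace I p) :
      S.g.val p (S.gradξ p u) (S.φ p w) = -S.g.val p (S.gradξ p (S.φ p w)) u := by
    have h := hS.closed.gradφ_cyclic (S.ξ p) u w
    rw [hS.gradφ_ξ_left, S.gradφ_ξ, S.val_ξ_left, S.η_gradφ, map_sub, map_neg,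
      S.g.symm p w, S.val_φ_left, S.g.symm p u (S.gradξ p (S.φ p w))] at h
    linarith
  have hv : v = -S.φ p (S.φ p v) + S.η p v • S.ξ p := by
    rw [S.φ_sq]
    module
  rw [hv]
  simp only [map_add, map_neg, map_smul, hS.gradξ_ξ, S.val_ξ_right, S.η_gradξ, key,
    neg_apply, smul_zero, add_zero]

theorem dη_eq_val (hS : S.IsAlmostQuasiSasakian) (u v : TangentSpace I p) :
    S.dη p u v = S.g.val p (S.gradξ p u) v := by
  rw [S.dη_eq, hS.val_gradξ v u]
  ring

/-- `ψ = ∇ ξ`. -/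
theorem ψ_eq (hS : S.IsAlmostQuasiSasakian) (p : M) : S.ψ p = S.gradξ p := by
  ext u
  refine S.g.ext_val fun w ↦ ?_
  rw [ψ, S.g.val_raise, hS.dη_eq_val]

/-- The canonical connection of an almost quasi-Sasakian structure. -/
theorem canonicalConnection_apply (hS : S.IsAlmostQuasiSasakian) (Y : VField I M)
    (u : TangentSpace I p) :
    S.canonicalConnection Y p u = S.g.leviCivita Y p u
      + S.g.val p (S.gradξ p u) (Y p) • S.ξ p - S.η p (Y p) • S.gradξ p u
      + S.η p u • S.gradξ p (Y p) := by
  obtain ⟨X, -, rfl⟩ := exists_mdiffAt_eq u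
  rw [canonicalConnection, S.nConnection_apply, S.covForm_η, S.covForm_η, hS.gradξ_ξ, sub_apply,
    add_apply, S.C_add_ψ, smul_apply, hS.ψ_eq, map_zero, zero_apply, mul_zero, zero_smul, gradξ]
  module

/-- The covariant derivative of `φ` along the canonical connection. -/
theorem covEndoTensor_canonicalConnection (hS : S.IsAlmostQuasiSasakian)
    (u v : TangentSpace I p) :
    covEndoTensor S.canonicalConnection S.φ S.smooth_φ p u v
      = S.gradφ p u v + S.g.val p (S.gradξ p u) (S.φ p v) • S.ξ p + S.η p v • S.φ p (S.gradξ p u)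
        + S.η p u • (S.gradξ p (S.φ p v) - S.φ p (S.gradξ p v)) := by
  obtain ⟨X, hX, rfl⟩ := exists_mdiffAt_eq u
  obtain ⟨Y, hY, rfl⟩ := exists_mdiffAt_eq v
  rw [covEndoTensor_apply _ S.smooth_φ hX hY, S.gradφ_apply hX hY, hS.canonicalConnection_apply,
    hS.canonicalConnection_apply]
  simp only [app, map_add, map_sub, map_smul, S.η_φ, S.φ_ξ]
  module

/-- An almost quasi-Sasakian structure is quasi-Sasakian iff `φ` commutes with `∇ ξ`. -/
theorem isQuasiSasakian_iff (hS : S.IsAlmostQuasiSasakian) :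
    S.IsQuasiSasakian ↔ ∀ (p : M) (u : TangentSpace I p),
      S.gradξ p (S.φ p u) = S.φ p (S.gradξ p u) := by
  have h : S.IsQuasiSasakian ↔ S.IsNormal := ⟨fun h ↦ h.normal, fun h ↦ ⟨hS.closed, h⟩⟩
  rw [h, hS.almostNormal.isNormal_iff]
  constructor
  · intro h p u
    refine S.g.ext_val fun w ↦ ?_
    have h1 := h p u (S.φ p w)
    rw [S.φ_sq, map_add, map_neg, map_smul, hS.dη_eq_val, hS.dη_eq_val, hS.dη_eq_val,
      S.val_ξ_right, S.η_gradξ] at h1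
    rw [S.val_φ_left, ← h1]
    simp
  · intro h p u v
    rw [hS.dη_eq_val, hS.dη_eq_val, h, S.compatible, S.η_gradξ]
    ring

end IsAlmostQuasiSasakian

/-- If `D` is skew-symmetric in its last two arguments, has vanishing cyclic sum, and satisfies the
relation expressing the vanishing of the Nijenhuis tensor of `φ` in terms of `D = ∇ φ`, then `D`
vanishes when its first argument is in the image of `φ`. -/
theorem eq_zero_of_cyclic {V : Type*} (φ : V → V) (D : V → V → V → ℝ)
    (skew : ∀ x y z, D x y z = -D x z y)
    (cyclic : ∀ x y z, D x y z + D y z x + D z x y = 0)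
    (nij : ∀ x y z, D (φ x) y z - D (φ y) x z - D y x (φ z) + D x y (φ z) = 0)
    (x y z : V) : D (φ x) y z = 0 := by
  have key (x y z : V) : D (φ x) y z + D (φ y) z x = D (φ z) x y := by
    have h1 := nij x y z
    have h2 := cyclic x y (φ z)
    have h3 := skew y (φ z) x
    have h4 := skew (φ y) x z
    linarith
  have h1 := key x y z
  have h2 := key y z x
  have h3 := key z x y
  linarith

/-- On a quasi-Sasakian manifold the structure endomorphism is parallel for the canonical
connection. -/
theorem IsAlmostQuasiSasakian.covEndoTensor_eq_zero [T2Space M] (hS : S.IsAlmostQuasiSasakian)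
    (hc : ∀ (p : M) (u : TangentSpace I p), S.gradξ p (S.φ p u) = S.φ p (S.gradξ p u))
    (u v : TangentSpace I p) :
    covEndoTensor S.canonicalConnection S.φ S.smooth_φ p u v = 0 := by
  set T := covEndoTensor S.canonicalConnection S.φ S.smooth_φ p with hT
  have hT_eq (u v : TangentSpace I p) : T u v = S.gradφ p u v
      + S.g.val p (S.gradξ p u) (S.φ p v) • S.ξ p + S.η p v • S.φ p (S.gradξ p u) := by
    rw [hT, hS.covEndoTensor_canonicalConnection, hc, sub_self, smul_zero, add_zero]
  have val_T (u v w : TangentSpace I p) : S.g.val p (T u v) w = S.g.val p (S.gradφ p u v) w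
      + S.g.val p (S.gradξ p u) (S.φ p v) * S.η p w
      - S.η p v * S.g.val p (S.gradξ p u) (S.φ p w) := by
    rw [hT_eq]
    simp only [map_add, map_smul, add_apply, smul_apply, smul_eq_mul, S.val_ξ_left, S.val_φ_left]
    ring
  have skew (u v w : TangentSpace I p) : S.g.val p (T u v) w = -S.g.val p (T u w) v := by
    rw [val_T, val_T, S.val_gradφ, S.g.symm p v]
    ring
  have hA (u v : TangentSpace I p) :
      S.g.val p (S.gradξ p u) (S.φ p v) = S.g.val p (S.gradξ p v) (S.φ p u) := by
    rw [hS.val_gradξ, hc, S.val_φ_left, neg_neg]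
  have cyclic (u v w : TangentSpace I p) :
      S.g.val p (T u v) w + S.g.val p (T v w) u + S.g.val p (T w u) v = 0 := by
    have h := hS.closed.gradφ_cyclic u w v
    rw [S.g.symm p w, S.g.symm p v, S.g.symm p u] at h
    rw [val_T, val_T, val_T, hA v u, hA w u, hA w v]
    have h1 := S.val_gradφ w u v
    linarith
  have nij (u v : TangentSpace I p) :
      T (S.φ p u) v - T (S.φ p v) u + S.φ p (T v u) - S.φ p (T u v) = 0 := by
    rw [← hS.almostNormal.gradφ_eq u v, hS.dη_eq_val]
    simp only [hT_eq, map_add, map_smul, S.φ_sq, S.φ_ξ, hc, S.compatible, S.η_gradξ,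
      hS.val_gradξ v u]
    module
  have hφ (x y z : TangentSpace I p) : S.g.val p (T (S.φ p x) y) z = 0 := by
    refine eq_zero_of_cyclic (S.φ p) (fun x y z ↦ S.g.val p (T x y) z) skew cyclic
      (fun x y z ↦ ?_) x y z
    have h := congrArg (fun t ↦ S.g.val p t z) (nij x y)
    simp only [map_sub, map_add, sub_apply, add_apply, S.val_φ_left, map_zero, zero_apply] at h
    linarith
  have hφ' (x y : TangentSpace I p) : T (S.φ p x) y = 0 :=
    S.g.nondegenerate p _ fun z ↦ hφ x y z
  have hξ (y : TangentSpace I p) : T (S.ξ p) y = 0 := by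
    rw [hT_eq, hS.gradφ_ξ_left, hc, hS.gradξ_ξ]
    simp
  have hu : u = -S.φ p (S.φ p u) + S.η p u • S.ξ p := by
    rw [S.φ_sq]
    module
  rw [hu, map_add, map_neg, map_smul, add_apply, neg_apply, smul_apply, hφ', hξ]
  simp

/-- An almost quasi-Sasakian structure is quasi-Sasakian iff its structure endomorphism is parallel
for the canonical connection. -/
theorem IsAlmostQuasiSasakian.isQuasiSasakian_iff_isParallelEndo [T2Space M]
    (hS : S.IsAlmostQuasiSasakian) :
    S.IsQuasiSasakian ↔ IsParallelEndo S.canonicalConnection S.φ := by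
  rw [hS.isQuasiSasakian_iff, isParallelEndo_iff _ S.smooth_φ]
  refine ⟨fun hc p u v ↦ hS.covEndoTensor_eq_zero hc u v, fun h p v ↦ ?_⟩
  have h1 := h p (S.ξ p) v
  rw [hS.covEndoTensor_canonicalConnection, hS.gradφ_ξ_left, hS.gradξ_ξ, S.η_ξ] at h1
  simp only [map_zero, zero_apply, zero_smul, smul_zero, add_zero, one_smul] at h1
  rw [← two_smul ℝ, smul_eq_zero_iff_right two_ne_zero] at h1
  exact sub_eq_zero.1 h1

end AlmostContactMetric

end ContactGeometry

end

theorem proposition6 (m : ℕ)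
    {M : Type*} [TopologicalSpace M] [T2Space M]
    [ChartedSpace (EuclideanSpace ℝ (Fin (2 * m + 1))) M] [IsManifold (𝓡 (2 * m + 1)) ∞ M]
    (S : ContactGeometry.AlmostContactMetric (𝓡 (2 * m + 1)) M)
    (hS : S.IsAlmostQuasiSasakian) :
    S.IsQuasiSasakian ↔ ContactGeometry.IsParallelEndo S.canonicalConnection S.φ := by
  exact hS.isQuasiSasakian_iff_isParallelEndo
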